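/- **Setting.** Let $(A,\mathfrak m)$ be a regular local ring of dimension $3$ which contains $\mathbb R$ and whose residue field is $\mathbb R$ (that is, $\mathbb R\to A/\mathfrak m$ is bijective), and let $u_1,u_2,u_3$ be generators of $\mathfrak m$. Let $\alpha$ be a point of the real spectrum of $A$, that is, a prime ideal $\mathfrak p_\alpha$ together with a total ordering of $\operatorname{Frac}(A/\mathfrak p_\alpha)$, and let $\nu=\nu_\alpha$ be the valuation of $\operatorname{Frac}(A/\mathfrak p_\alpha)$ whose valuation ring is the convex hull $\{x : |x|\le c \text{ for some } c\in A/\mathfrak p_\alpha\}$. For $a\in A$ write $\nu(a)$ for $\nu(a \bmod \mathfrak p_\alpha)$, with $\nu(0)=\infty$. Assume that $\alpha$ is centered at $\mathfrak m$: $\nu(a)>0$ for all $a\in\mathfrak m$. **Approximate roots.** The system of approximate roots of $\nu$ is a well-ordered family $\mathbf Q=(Q_i)_{i\in\Lambda}$ of elements of $A$ whose first members are $u_1,u_2,u_3$ in this order. A *generalized monomial* is a finite product $\mathbf Q^\eta=\prod_i Q_i^{\eta_i}$, $\eta_i\in\mathbb N$; divisibility of generalized monomials is that of their exponent vectors, and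 generalized monomials are ordered by the lexicographical order of the pairs $(\nu(\mathbf Q^\eta),\eta)$. Every member $Q$ other than $u_1,u_2,u_3$ carries an *initial monomial* and an *expression* $Ex(Q)$, a formal real linear combination of generalized monomials in members preceding $Q$, and is obtained by the following recursion on the finite values $\gamma$ of $\nu$. Call a generalized monomial of value $\gamma$ *standard* if it is not divisible by the initial monomial, of value less than $\gamma$, of any member. Call a standard monomial $M$ of value $\gamma$ *dependent* if $\nu\bigl(M-\sum_j c_jM_j\bigr)>\gamma$ for some $c_j\in\mathbb R$ and finitely many standard monomials $M_j$ of value $\gamma$ that are greater than $M$ in the order above. Each dependent standard monomial $M$ of value $\gamma$ is the initial monomial of exactly one new member $Q$, where $Q=Ex(Q)=M-\sum_j c_jM_j$, the $M_j$ are standard, of value $\gamma$, greater than $M$ and not dependent, and $\nu(Q)>\gamma$. All members other than $u_1,u_2,u_3$ arise in this way. The approximate roots of *complexity* $0$ are $u_1,u_2,u_3$; another member $Q$ is of complexity $c\ge 1$ if all approximate roots appearing in $Ex(Q)$ are of complexity at most $c-1$ and at least one of them is of complexity exactly $c-1$. **Lemma 6.1.** The valuation $\nu$ has at most three approximate roots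 of complexity one. The expression of each of them is a binomial of one of the following forms, with $\lambda_i\in\mathbb R\setminus\{0\}$, the first monomial being the initial one: $$u_2^{\beta_1}u_3^{\gamma_1}-\lambda_1u_1^{\alpha_1}\quad(\alpha_1,\beta_1,\gamma_1\ge 1),\tag{27}$$ $$u_2^{\beta_2}-\lambda_2u_1^{\alpha_2}u_3^{\gamma_2}\quad(\alpha_2,\beta_2\ge 1,\ \gamma_2\ge 0),\tag{28}$$ $$u_3^{\gamma_3}-\lambda_3u_1^{\alpha_3}u_2^{\beta_3}\quad(\gamma_3\ge 1,\ \alpha_3,\beta_3\ge 0).\tag{29}$$ There is at most one approximate root of complexity one of each form. Moreover $\alpha_1,\beta_2,\gamma_3$ are the smallest exponents possible: $\alpha_1$ (respectively $\beta_2$, $\gamma_3$) is the least one among all pairs of monomials in $u_1,u_2,u_3$ of equal finite value whose exponents are as in (27) (respectively (28), (29)), including the stated positivity conditions. -/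

import Mathlib

/-- `ν` is the valuation attached to the point `α` of the real spectrum of `A` (a point of the real
spectrum being an ordering of `A`, with prime support `𝔭 = α ∩ -α`).  Its valuation ring is the
convex hull of `A/𝔭` in the ordered field `Frac (A/𝔭)`, that is, the ring of all `x` with
`|x| ≤ |c|` for some `c ∈ A`.  Hence `ν a ≤ ν b` (Mathlib's valuations are multiplicative, and the
value `0` plays the role of `∞`) means `|a| ≤ |b c|` in `A/𝔭` for some `c ∈ A`, and
`|x| ≤ |y|` is written as `y ^ 2 - x ^ 2 ∈ α`. -/
def IsValuationOfPoint {A Γ₀ : Type*} [CommRing A] [LinearOrderedCommGroupWithZero Γ₀]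
    (α : RingPreordering A) (ν : Valuation A Γ₀) : Prop :=
  ∀ a b : A, ν a ≤ ν b ↔ ∃ c : A, (b * c) ^ 2 - a ^ 2 ∈ α

/-- A family of elements `Q i` of `A` indexed by an ordered set `Λ`, among which are `n`
distinguished ones (the parameters), together with an expression `Ex (Q i)`, which is a formal real
linear combination of generalized monomials in the family, and an initial monomial.  (The
expression and the initial monomial are meaningful only when `i` is not a parameter.) -/
structure RootData (A : Type*) (n : ℕ) (Λ : Type*) where
  root : Λ → A
  param : Fin n → Λ
  expr : Λ → MvPolynomial Λ ℝ
  initial : Λ → (Λ →₀ ℕ)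

namespace RootData

/-- The generalized monomial `∏ i, Q i ^ e i`. -/
def mon {A Λ : Type*} [CommRing A] {n : ℕ} (D : RootData A n Λ) (e : Λ →₀ ℕ) : A :=
  e.prod fun i m => D.root i ^ m

/-- Members of the family other than the parameters. -/
def IsNew {A Λ : Type*} {n : ℕ} (D : RootData A n Λ) (i : Λ) : Prop :=
  i ∉ Set.range D.param

/-- A generalized monomial of finite value is standard if it is not divisible by the initial
monomial of any root created at an earlier stage.  (A root is created at the stage given by the
value of its initial monomial; multiplicatively, earlier stages are the larger ones.) -/
def IsStandard {A Γ₀ Λ : Type*} [CommRing A] [LinearOrderedCommGroupWithZero Γ₀] {n : ℕ}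
    (D : RootData A n Λ) (ν : Valuation A Γ₀) (e : Λ →₀ ℕ) : Prop :=
  ν (D.mon e) ≠ 0 ∧
    ∀ i, D.IsNew i → ν (D.mon e) < ν (D.mon (D.initial i)) → ¬ D.initial i ≤ e

/-- `e'` is a standard monomial of the same value as `e` that comes after `e` in the order of
generalized monomials, the lexicographical order of the pairs (value, exponent vector). -/
def Follows {A Γ₀ Λ : Type*} [CommRing A] [LinearOrderedCommGroupWithZero Γ₀] [LinearOrder Λ]
    {n : ℕ} (D : RootData A n Λ) (ν : Valuation A Γ₀) (e e' : Λ →₀ ℕ) : Prop :=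
  D.IsStandard ν e' ∧ ν (D.mon e') = ν (D.mon e) ∧ toLex e < toLex e'

/-- The initial form of the monomial `e` in the graded ring of `ν` is a real linear combination of
the initial forms of the standard monomials of the same value that come after `e`. -/
def IsDependent {A Γ₀ Λ : Type*} [CommRing A] [Algebra ℝ A] [LinearOrderedCommGroupWithZero Γ₀]
    [LinearOrder Λ] {n : ℕ} (D : RootData A n Λ) (ν : Valuation A Γ₀) (e : Λ →₀ ℕ) : Prop :=
  ∃ p : MvPolynomial Λ ℝ, (∀ e' ∈ p.support, D.Follows ν e e') ∧
    ν (D.mon e - MvPolynomial.aeval D.root p) < ν (D.mon e)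

/-- `D` is the system of approximate roots of `ν` with respect to the parameters `u`, as it results
from the recursive construction: at the stage `γ` one considers the standard monomials of value `γ`
in the roots found so far.  Those that are not dependent on later ones form a basis (modulo higher
value), and each dependent one, `M`, gives one new approximate root, namely the difference of `M`
and the linear combination of later basis monomials with the same initial form as `M`. -/
structure IsApproxRootSystem {A Γ₀ Λ : Type*} [CommRing A] [Algebra ℝ A]
    [LinearOrderedCommGroupWithZero Γ₀] [LinearOrder Λ] {n : ℕ}
    (D : RootData A n Λ) (ν : Valuation A Γ₀) (u : Fin n → A) : Prop where
  /-- the roots are well-ordered -/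
  wellFounded : WellFoundedLT Λ
  /-- the first roots are `u_1, …, u_n`, in this order -/
  root_param : ∀ k, D.root (D.param k) = u k
  param_strictMono : StrictMono D.param
  param_lt : ∀ i, D.IsNew i → ∀ k, D.param k < i
  /-- `Ex (Q i)` involves only approximate roots that precede `Q i` -/
  precedes : ∀ i, D.IsNew i → ∀ j ∈ (D.expr i).vars, j < i
  /-- initial monomials are standard and dependent on later standard monomials -/
  initial_spec : ∀ i, D.IsNew i →
    D.IsStandard ν (D.initial i) ∧ D.IsDependent ν (D.initial i)
  /-- every such monomial is the initial monomial of exactly one new root -/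
  existsUnique_initial : ∀ e, D.IsStandard ν e → D.IsDependent ν e →
    ∃! i, D.IsNew i ∧ D.initial i = e
  /-- `Ex (Q i)` is the initial monomial minus a combination of later basis monomials -/
  expr_spec : ∀ i, D.IsNew i →
    ∀ e' ∈ (MvPolynomial.monomial (D.initial i) (1 : ℝ) - D.expr i).support,
      D.Follows ν (D.initial i) e' ∧ ¬ D.IsDependent ν e'
  /-- `Q i` is the element of `A` given by its expression -/
  root_eq : ∀ i, D.IsNew i → D.root i = MvPolynomial.aeval D.root (D.expr i)
  /-- the value of `Q i` is greater than the value of the monomials of its expression -/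
  val_root_lt : ∀ i, D.IsNew i → ν (D.root i) < ν (D.mon (D.initial i))

/-- The approximate root `Q i` is of complexity `c`: the parameters are those of complexity `0`,
and `Q i` is of complexity `c + 1` if all roots appearing in its expression are of complexity at
most `c` and at least one of them is of complexity exactly `c`. -/
def HasComplexity {A Λ : Type*} {n : ℕ} (D : RootData A n Λ) : ℕ → Λ → Prop
  | 0, i => i ∈ Set.range D.param
  | c + 1, i => D.IsNew i ∧
      (∀ j ∈ (D.expr i).vars, ∃ k : Fin (c + 1), D.HasComplexity k j) ∧
      ∃ j ∈ (D.expr i).vars, D.HasComplexity c j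
  termination_by c => c

/-- `Ex (Q i)` is `u₂ ^ β u₃ ^ γ - l u₁ ^ α`, the initial monomial being the first one and `β`, `γ`
being positive, and `α` is the smallest exponent possible: it is the least for which there is a
monomial `u₂ ^ β' u₃ ^ γ'` (with `β'`, `γ'` positive) of the same finite value as `u₁ ^ α`. -/
def IsMixedForm {A Γ₀ Λ : Type*} [CommRing A] [LinearOrderedCommGroupWithZero Γ₀]
    (D : RootData A 3 Λ) (ν : Valuation A Γ₀) (u : Fin 3 → A) (i : Λ) : Prop :=
  ∃ (α β γ : ℕ) (l : ℝ), 0 < α ∧ 0 < β ∧ 0 < γ ∧ l ≠ 0 ∧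
    D.expr i = MvPolynomial.X (D.param 1) ^ β * MvPolynomial.X (D.param 2) ^ γ
      - MvPolynomial.C l * MvPolynomial.X (D.param 0) ^ α ∧
    D.initial i = Finsupp.single (D.param 1) β + Finsupp.single (D.param 2) γ ∧
    IsLeast {α' : ℕ | ∃ β' γ' : ℕ, 0 < β' ∧ 0 < γ' ∧
      ν (u 1 ^ β' * u 2 ^ γ') = ν (u 0 ^ α') ∧ ν (u 0 ^ α') ≠ 0} α

/-- `Ex (Q i)` is `u₂ ^ β - l u₁ ^ α u₃ ^ γ`, the initial monomial being the first one (so that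
`α` is positive), and `β` is the smallest exponent possible. -/
def IsSecondPowerForm {A Γ₀ Λ : Type*} [CommRing A] [LinearOrderedCommGroupWithZero Γ₀]
    (D : RootData A 3 Λ) (ν : Valuation A Γ₀) (u : Fin 3 → A) (i : Λ) : Prop :=
  ∃ (α β γ : ℕ) (l : ℝ), 0 < α ∧ 0 < β ∧ l ≠ 0 ∧
    D.expr i = MvPolynomial.X (D.param 1) ^ β
      - MvPolynomial.C l * (MvPolynomial.X (D.param 0) ^ α * MvPolynomial.X (D.param 2) ^ γ) ∧
    D.initial i = Finsupp.single (D.param 1) β ∧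
    IsLeast {β' : ℕ | 0 < β' ∧ ∃ α' γ' : ℕ, 0 < α' ∧
      ν (u 1 ^ β') = ν (u 0 ^ α' * u 2 ^ γ') ∧ ν (u 1 ^ β') ≠ 0} β

/-- `Ex (Q i)` is `u₃ ^ γ - l u₁ ^ α u₂ ^ β`, the initial monomial being the first one, and `γ` is
the smallest exponent possible. -/
def IsThirdPowerForm {A Γ₀ Λ : Type*} [CommRing A] [LinearOrderedCommGroupWithZero Γ₀]
    (D : RootData A 3 Λ) (ν : Valuation A Γ₀) (u : Fin 3 → A) (i : Λ) : Prop :=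
  ∃ (α β γ : ℕ) (l : ℝ), 0 < γ ∧ l ≠ 0 ∧
    D.expr i = MvPolynomial.X (D.param 2) ^ γ
      - MvPolynomial.C l * (MvPolynomial.X (D.param 0) ^ α * MvPolynomial.X (D.param 1) ^ β) ∧
    D.initial i = Finsupp.single (D.param 2) γ ∧
    IsLeast {γ' : ℕ | 0 < γ' ∧ ∃ α' β' : ℕ,
      ν (u 2 ^ γ') = ν (u 0 ^ α' * u 1 ^ β') ∧ ν (u 2 ^ γ') ≠ 0} γ

end RootData

/-! The residue field of `ν` is `ℝ`, so any two elements of the same finite value are proportional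
modulo higher value (`IsValuationOfPoint.exists_map_sub_lt`). A standard monomial is therefore
dependent as soon as a single later standard monomial shares its value, and every expression is a
binomial. The values of `ν` on the Noetherian ring `A` are well-ordered, which gives each finite
value attained by a monomial a greatest one, and that one is standard. Hence a proper divisor of a
standard monomial is greatest of its value: otherwise it would be an earlier initial monomial
(`not_lex_lt_of_proper_divisor`). Everything else follows from this. The two monomials of an
expression are coprime; in complexity one, coprimality and the order leave three shapes; a smaller
exponent than the one found, or a second root of the same shape, would yield a proper divisor of an
initial monomial that is not greatest. -/

/-! ### The residue field of the valuation of a real point. -/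

section RealSpectrum

variable {A Γ₀ : Type*} [CommRing A] [LinearOrderedCommGroupWithZero Γ₀]
  {α : RingPreordering A} {ν : Valuation A Γ₀}

theorem IsValuationOfPoint.map_le_one (hν : IsValuationOfPoint α ν) (a : A) : ν a ≤ 1 := by
  rw [← ν.map_one, hν]
  exact ⟨a, by simp⟩

/-- Values are compared through squares, so the hypothesis is the comparison of `b ^ 2` with `0`. -/
theorem IsValuationOfPoint.map_eq_zero_of_neg_pow_four_mem (hν : IsValuationOfPoint α ν) {b : A}
    (hb : -b ^ 4 ∈ α) : ν b = 0 := by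
  have h : ν (b ^ 2) ≤ ν 0 := (hν _ _).2 ⟨1, by convert hb using 1; ring⟩
  rw [ν.map_zero, map_pow] at h
  exact eq_zero_of_pow_eq_zero (le_antisymm h zero_le)

variable [Algebra ℝ A]

theorem RingPreordering.algebraMap_mem (α : RingPreordering A) {t : ℝ} (ht : 0 ≤ t) :
    algebraMap ℝ A t ∈ α := by
  rw [← Real.sq_sqrt ht, map_pow]
  exact α.pow_two_mem _

theorem IsValuationOfPoint.map_eq_zero_of_real_mul_mem (hν : IsValuationOfPoint α ν) {b : A}
    {t : ℝ} (ht : t < 0) (hb : algebraMap ℝ A t * b ^ 4 ∈ α) : ν b = 0 := by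
  apply hν.map_eq_zero_of_neg_pow_four_mem
  have h := mul_mem (α.algebraMap_mem (t := -t⁻¹) (by simpa using ht.le)) hb
  convert h using 1
  rw [← mul_assoc, ← map_mul, neg_mul, inv_mul_cancel₀ ht.ne]
  simp

variable [IsLocalRing A]

/-- Every element of `A` is bounded by a real number. -/
theorem IsValuationOfPoint.exists_real_sub_sq_mem [HasMemOrNegMem α]
    (hν : IsValuationOfPoint α ν)
    (hres : Function.Surjective (algebraMap ℝ (IsLocalRing.ResidueField A)))
    (hcent : ∀ a ∈ IsLocalRing.maximalIdeal A, ν a < 1) (c : A) :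
    ∃ K : ℝ, 1 ≤ K ∧ algebraMap ℝ A K - c ^ 2 ∈ α := by
  obtain ⟨r, hr⟩ := hres (IsLocalRing.residue A c)
  obtain ⟨m, rfl⟩ : ∃ m, c = algebraMap ℝ A r + m := ⟨c - algebraMap ℝ A r, by ring⟩
  have hm : m ∈ IsLocalRing.maximalIdeal A := by
    rw [IsScalarTower.algebraMap_apply ℝ A (IsLocalRing.ResidueField A), map_add] at hr
    rw [← IsLocalRing.residue_eq_zero_iff]
    simpa using hr
  have h1 : 1 - m ^ 2 ∈ α := by
    have h := (hcent m hm).not_ge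
    rw [← ν.map_one, hν] at h
    push Not at h
    have h2 := (mem_or_neg_mem α ((m * 1) ^ 2 - 1 ^ 2)).resolve_left (h 1)
    convert h2 using 1
    ring
  -- `2 (r² + 1) - (r + m)² = (r - m)² + 2 (1 - m²)`.
  refine ⟨2 * (r ^ 2 + 1), by nlinarith, ?_⟩
  have h3 := add_mem (α.pow_two_mem (algebraMap ℝ A r - m)) (add_mem h1 h1)
  convert h3 using 1
  simp only [map_mul, map_add, map_pow, map_one, map_ofNat]
  ring

/-- The residue field of the valuation is `ℝ`: two elements of the same finite value have
proportional initial forms. -/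
theorem IsValuationOfPoint.exists_map_sub_lt [HasMemOrNegMem α] (hν : IsValuationOfPoint α ν)
    (hres : Function.Surjective (algebraMap ℝ (IsLocalRing.ResidueField A)))
    (hcent : ∀ a ∈ IsLocalRing.maximalIdeal A, ν a < 1) {a b : A} (hab : ν a ≤ ν b)
    (hb : ν b ≠ 0) : ∃ t : ℝ, ν (a - algebraMap ℝ A t * b) < ν b := by
  -- If `a² ≤ K b²`, then `a / b` cannot reach `K + 1`, because `K < (K + 1)²`.
  have key : ∀ K : ℝ, 1 ≤ K → ∀ a : A, algebraMap ℝ A K * b ^ 2 - a ^ 2 ∈ α →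
      b * (a - algebraMap ℝ A (K + 1) * b) ∉ α := by
    intro K hK a ha h
    refine hb (hν.map_eq_zero_of_real_mul_mem (t := K - (K + 1) ^ 2) (by nlinarith) ?_)
    have h1 := add_mem h (mul_mem (α.algebraMap_mem (t := 2 * (K + 1)) (by linarith))
      (α.pow_two_mem b))
    have h2 := add_mem (mul_mem h h1) (mul_mem ha (α.pow_two_mem b))
    convert h2 using 1
    simp only [map_mul, map_add, map_sub, map_pow, map_one, map_ofNat]
    ring
  -- The real lower cut of `a / b`; its supremum will be the residue of `a / b`.
  set S : Set ℝ := {t | b * (a - algebraMap ℝ A t * b) ∈ α} with hS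
  have hdown : ∀ t ∈ S, ∀ s ≤ t, s ∈ S := by
    intro t ht s hst
    have h := add_mem ht (mul_mem (α.algebraMap_mem (sub_nonneg.2 hst)) (α.pow_two_mem b))
    change b * (a - algebraMap ℝ A s * b) ∈ α
    convert h using 1
    rw [map_sub]
    ring
  obtain ⟨c, hc⟩ := (hν a b).1 hab
  obtain ⟨K, hK, hcK⟩ := hν.exists_real_sub_sq_mem hres hcent c
  have haK : algebraMap ℝ A K * b ^ 2 - a ^ 2 ∈ α := by
    have h := add_mem hc (mul_mem hcK (α.pow_two_mem b))
    convert h using 1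
    ring
  have hbdd : BddAbove S := by
    refine ⟨K + 1, fun t ht => ?_⟩
    by_contra! hlt
    exact key K hK a haK (hdown t ht _ hlt.le)
  have hne : S.Nonempty := by
    refine ⟨-(K + 1), ?_⟩
    have h := key K hK (-a) (by simpa using haK)
    have h2 := (mem_or_neg_mem α (b * (-a - algebraMap ℝ A (K + 1) * b))).resolve_left h
    change b * (a - algebraMap ℝ A (-(K + 1)) * b) ∈ α
    convert h2 using 1
    rw [map_neg]
    ring
  refine ⟨sSup S, ?_⟩
  by_contra! hle
  obtain ⟨c', hc'⟩ := (hν _ _).1 hle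
  obtain ⟨R, hR, hcR⟩ := hν.exists_real_sub_sq_mem hres hcent c'
  set l := sSup S with hl
  -- If the claim fails, `b² ≤ R d²` for `d = a - l b`, while `l - ε ≤ a / b ≤ l + ε` gives `d² ≤ ε²
  -- b²`. This `ε` makes `R ε² < 1`, a contradiction.
  set ε : ℝ := 1 / (2 * R) with hε
  have hε0 : 0 < ε := by positivity
  obtain ⟨s, hs, hls⟩ := exists_lt_of_lt_csSup hne (sub_lt_self l hε0)
  have h1 : b * (a - algebraMap ℝ A (l - ε) * b) ∈ α := hdown s hs _ hls.le
  have h2 : b * (a - algebraMap ℝ A (l + ε) * b) ∉ α := fun h =>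
    absurd (le_csSup hbdd h) (by linarith)
  have h3 := (mem_or_neg_mem α _).resolve_left h2
  have hRε : R * ε = 1 / 2 := by rw [hε]; field_simp
  refine hb (hν.map_eq_zero_of_real_mul_mem (t := R * ε ^ 2 - 1) ?_ ?_)
  · have : ε ≤ 1 := by rw [hε, div_le_one (by positivity)]; linarith
    nlinarith
  · set d := a - algebraMap ℝ A l * b with hd
    have h4 := mul_mem h1 h3
    have h5 := add_mem hc' (mul_mem hcR (α.pow_two_mem d))
    have h6 := add_mem (mul_mem h5 (α.pow_two_mem b))
      (mul_mem (α.algebraMap_mem (t := R) (by linarith)) h4)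
    convert h6 using 1
    simp only [hd, map_mul, map_add, map_sub, map_pow, map_one]
    ring

end RealSpectrum

/-! ### Well-ordered values and greatest monomials. -/

/-- The sets `{x | ν x ≤ ν a}` are ideals that grow strictly with `ν a`, so the ascending chain
condition applies. -/
theorem Valuation.wellFounded_gt_of_le_one {A Γ₀ : Type*} [CommRing A] [IsNoetherianRing A]
    [LinearOrderedCommGroupWithZero Γ₀] {ν : Valuation A Γ₀} (h1 : ∀ a, ν a ≤ 1) :
    WellFounded fun a b : A => ν b < ν a := by
  let I : A → Ideal A := fun a =>
    { carrier := {x | ν x ≤ ν a}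
      add_mem' := fun hx hy => ν.map_add_le hx hy
      zero_mem' := by simp
      smul_mem' := fun c x hx => by
        change ν (c * x) ≤ ν a
        rw [map_mul]
        exact (mul_le_of_le_one_left' (h1 c)).trans hx }
  have hI : ∀ a b, ν b < ν a → I b < I a := fun a b hab =>
    lt_of_le_of_ne (fun x (hx : ν x ≤ ν b) => hx.trans hab.le) fun h =>
      hab.not_ge (show a ∈ I b from h ▸ (le_rfl : ν a ≤ ν a))
  exact Subrelation.wf (fun {a b} hab => hI a b hab)
    (InvImage.wf I (wellFounded_gt (α := Ideal A)))

namespace RootData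

section Monomials

variable {A Λ : Type*} [CommRing A] {n : ℕ} (D : RootData A n Λ)

theorem mon_zero : D.mon 0 = 1 := by simp [mon]

theorem mon_add (e f : Λ →₀ ℕ) : D.mon (e + f) = D.mon e * D.mon f := by
  classical
  exact Finsupp.prod_add_index' (by simp) (fun _ _ _ => pow_add _ _ _)

theorem mon_single (i : Λ) (m : ℕ) : D.mon (Finsupp.single i m) = D.root i ^ m := by
  simp [mon]

theorem aeval_monomial_root [Algebra ℝ A] (e : Λ →₀ ℕ) (t : ℝ) :
    MvPolynomial.aeval D.root (MvPolynomial.monomial e t) = algebraMap ℝ A t * D.mon e := by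
  rw [MvPolynomial.aeval_monomial]
  rfl

end Monomials

variable {A Γ₀ Λ : Type*} [CommRing A] [LinearOrderedCommGroupWithZero Γ₀] {n : ℕ}
  {D : RootData A n Λ} {ν : Valuation A Γ₀}

theorem map_mon_lt_one (hle : ∀ a, ν a ≤ 1) (hroot : ∀ i, ν (D.root i) < 1) {e : Λ →₀ ℕ}
    (he : e ≠ 0) : ν (D.mon e) < 1 := by
  obtain ⟨i, hi⟩ := Finsupp.ne_iff.1 he
  obtain ⟨f, rfl⟩ : ∃ f, e = Finsupp.single i 1 + f :=
    exists_add_of_le (Finsupp.single_le_iff.2 (Nat.one_le_iff_ne_zero.2 hi))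
  rw [mon_add, mon_single, pow_one, map_mul]
  exact mul_lt_one_of_lt_of_le (hroot i) (hle _)

theorem map_mon_lt_of_lt (hle : ∀ a, ν a ≤ 1) (hroot : ∀ i, ν (D.root i) < 1)
    {e f : Λ →₀ ℕ} (he : ν (D.mon e) ≠ 0) (hfe : f ≤ e) (hne : f ≠ e) :
    ν (D.mon e) < ν (D.mon f) := by
  obtain ⟨r, rfl⟩ := exists_add_of_le hfe
  rw [mon_add, map_mul] at he ⊢
  refine mul_lt_of_lt_one_right (zero_lt_iff.2 (left_ne_zero_of_mul he)) ?_
  exact map_mon_lt_one hle hroot (by rintro rfl; simp at hne)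

/-- A root created before the stage of the divisor is also created before that of the multiple. -/
theorem IsStandard.of_le (hle : ∀ a, ν a ≤ 1) {e f : Λ →₀ ℕ} (he : D.IsStandard ν e)
    (hfe : f ≤ e) : D.IsStandard ν f := by
  have h0 := he.1
  obtain ⟨r, rfl⟩ := exists_add_of_le hfe
  rw [mon_add, map_mul] at h0
  refine ⟨left_ne_zero_of_mul h0, fun i hi hlt hif => he.2 i hi (lt_of_le_of_lt ?_ hlt)
    (hif.trans hfe)⟩
  rw [mon_add, map_mul]
  exact mul_le_of_le_one_right' (hle _)

variable [LinearOrder Λ]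

/-- A nonempty set of generalized monomials of the same finite value has a greatest element. -/
theorem exists_lex_max [WellFoundedLT Λ] [IsNoetherianRing A] (hle : ∀ a, ν a ≤ 1)
    (hroot : ∀ i, ν (D.root i) < 1) (e : Λ →₀ ℕ) (he : ν (D.mon e) ≠ 0)
    (S : Set (Λ →₀ ℕ)) (heS : e ∈ S) (hS : ∀ f ∈ S, ν (D.mon f) = ν (D.mon e)) :
    ∃ g ∈ S, ∀ f ∈ S, toLex f ≤ toLex g := by
  obtain ⟨x, hx⟩ : ∃ x, x = D.mon e := ⟨_, rfl⟩
  induction x using (Valuation.wellFounded_gt_of_le_one hle).induction generalizing e S with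
  | _ x ih =>
  subst hx
  by_cases hS0 : ∀ f ∈ S, f = 0
  · exact ⟨e, heS, fun f hf => by rw [hS0 f hf, hS0 e heS]⟩
  push Not at hS0
  obtain ⟨f₀, hf₀, hne⟩ := hS0
  obtain ⟨i₀, hi₀⟩ := Finsupp.ne_iff.1 hne
  -- `k` is the first index used by any monomial of `S`. Members that use it exceed those that do
  -- not; dividing them by `Q k` gives a set of larger `ν`, to which induction applies.
  obtain ⟨k, ⟨f₁, hf₁, hk⟩, hmin⟩ := (wellFounded_lt (α := Λ)).has_min
    {i | ∃ f ∈ S, f i ≠ 0} ⟨i₀, f₀, hf₀, hi₀⟩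
  have hsplit : ∀ f : Λ →₀ ℕ, f k ≠ 0 → ∃ f', f = Finsupp.single k 1 + f' := fun f hf =>
    exists_add_of_le (Finsupp.single_le_iff.2 (Nat.one_le_iff_ne_zero.2 hf))
  obtain ⟨f₁', rfl⟩ := hsplit f₁ hk
  have hv₁ := hS _ hf₁
  rw [mon_add, mon_single, pow_one, map_mul] at hv₁
  have hmul0 : ν (D.root k) * ν (D.mon f₁') ≠ 0 := hv₁ ▸ he
  have h10 := right_ne_zero_of_mul hmul0
  have hlt : ν (D.mon e) < ν (D.mon f₁') := by
    rw [← hv₁]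
    exact mul_lt_of_lt_one_left (zero_lt_iff.2 h10) (hroot k)
  obtain ⟨g, hg, hgmax⟩ := ih _ hlt f₁' h10 {f | Finsupp.single k 1 + f ∈ S} hf₁ (by
    intro f hf
    have := hS _ hf
    rw [mon_add, mon_single, pow_one, map_mul, ← hv₁] at this
    exact mul_left_cancel₀ (left_ne_zero_of_mul hmul0) this) rfl
  refine ⟨_, hg, fun f hf => ?_⟩
  by_cases hfk : f k = 0
  · refine le_of_lt (Finsupp.Lex.lt_iff.2 ⟨k, fun j hj => ?_, ?_⟩)
    · have h1 : f j = 0 := by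
        by_contra h
        exact hmin j ⟨f, hf, h⟩ hj
      have h2 : (Finsupp.single k 1 + g : Λ →₀ ℕ) j = 0 := by
        by_contra h
        exact hmin j ⟨_, hg, h⟩ hj
      exact h1.trans h2.symm
    · change f k < (Finsupp.single k 1 + g : Λ →₀ ℕ) k
      simp [hfk]
  · obtain ⟨f', rfl⟩ := hsplit f hfk
    rw [toLex_add, toLex_add]
    exact add_le_add_right (hgmax f' hf) _

variable [Algebra ℝ A]

theorem IsDependent.exists_follows {e : Λ →₀ ℕ} (he : D.IsDependent ν e) :
    ∃ f, D.Follows ν e f := by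
  obtain ⟨p, hp, hlt⟩ := he
  by_contra! h
  have : p = 0 := by
    rw [← MvPolynomial.support_eq_empty, Finset.eq_empty_iff_forall_notMem]
    exact fun f hf => h f (hp f hf)
  simp [this] at hlt

/-- Each graded piece is at most one-dimensional, so one later standard monomial suffices. -/
theorem Follows.isDependent (hprop : ∀ {a b : A}, ν a ≤ ν b → ν b ≠ 0 →
      ∃ t : ℝ, ν (a - algebraMap ℝ A t * b) < ν b) {e f : Λ →₀ ℕ} (h : D.Follows ν e f) :
    D.IsDependent ν e := by
  obtain ⟨t, ht⟩ := hprop h.2.1.ge h.1.1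
  refine ⟨MvPolynomial.monomial f t, fun e' he' => ?_, ?_⟩
  · rwa [Finset.mem_singleton.1 (MvPolynomial.support_monomial_subset he')]
  · rwa [aeval_monomial_root, ← h.2.1]

namespace IsApproxRootSystem

variable {u : Fin n → A}

theorem map_root_lt_one (hD : D.IsApproxRootSystem ν u) (hle : ∀ a, ν a ≤ 1)
    (hu : ∀ k, ν (u k) < 1) (i : Λ) : ν (D.root i) < 1 := by
  by_cases hi : D.IsNew i
  · exact (hD.val_root_lt i hi).trans_le (hle _)
  · obtain ⟨k, rfl⟩ := not_not.1 hi
    rw [hD.root_param]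
    exact hu k

/-- The greatest generalized monomial of a given finite value is standard. -/
theorem isStandard_of_lex_max (hD : D.IsApproxRootSystem ν u) {g : Λ →₀ ℕ}
    (hg : ν (D.mon g) ≠ 0)
    (hmax : ∀ f, ν (D.mon f) = ν (D.mon g) → toLex f ≤ toLex g) : D.IsStandard ν g := by
  refine ⟨hg, fun i hi _ hle => ?_⟩
  obtain ⟨r, rfl⟩ := exists_add_of_le hle
  -- Replacing the factor `D.initial i` by a later monomial of the same value would produce a
  -- monomial greater than `g`.
  obtain ⟨h, -, hval, hlt⟩ := (hD.initial_spec i hi).2.exists_follows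
  refine (hmax (h + r) (by rw [mon_add, mon_add, map_mul, map_mul, hval])).not_gt ?_
  rw [toLex_add, toLex_add]
  exact add_lt_add_left hlt _

variable [IsNoetherianRing A]

/-- `f` need not be standard; the greatest monomial of its value is, and lies after `e`. -/
theorem exists_follows (hD : D.IsApproxRootSystem ν u) (hle : ∀ a, ν a ≤ 1)
    (hu : ∀ k, ν (u k) < 1) {e f : Λ →₀ ℕ} (he : ν (D.mon e) ≠ 0)
    (hef : ν (D.mon e) = ν (D.mon f)) (hlt : toLex e < toLex f) : ∃ g, D.Follows ν e g := by
  have := hD.wellFounded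
  obtain ⟨g, hg, hmax⟩ := exists_lex_max hle (hD.map_root_lt_one hle hu) e he
    {f | ν (D.mon f) = ν (D.mon e)} rfl (fun _ h => h)
  have hg' : ν (D.mon g) = ν (D.mon e) := hg
  refine ⟨g, hD.isStandard_of_lex_max (hg' ▸ he) fun f hf => hmax f (hf.trans hg'), hg, ?_⟩
  exact hlt.trans_le (hmax f hef.symm)

/-- A proper divisor of a standard monomial is the greatest monomial of its value. -/
theorem not_lex_lt_of_proper_divisor (hD : D.IsApproxRootSystem ν u) (hle : ∀ a, ν a ≤ 1)
    (hu : ∀ k, ν (u k) < 1)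
    (hprop : ∀ {a b : A}, ν a ≤ ν b → ν b ≠ 0 → ∃ t : ℝ, ν (a - algebraMap ℝ A t * b) < ν b)
    {e f f' : Λ →₀ ℕ} (he : D.IsStandard ν e) (hfe : f ≤ e) (hne : f ≠ e)
    (hval : ν (D.mon f) = ν (D.mon f')) : ¬ toLex f < toLex f' := by
  intro hlt
  have hf := he.of_le hle hfe
  obtain ⟨g, hg⟩ := hD.exists_follows hle hu hf.1 hval hlt
  -- Being dependent, `f` is the initial monomial of a root; as a proper divisor it belongs to an
  -- earlier stage, which contradicts the standardness of `e`.
  obtain ⟨i, ⟨hi, rfl⟩, -⟩ := hD.existsUnique_initial f hf (hg.isDependent hprop)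
  exact he.2 i hi (map_mon_lt_of_lt hle (hD.map_root_lt_one hle hu) he.1 hfe hne) hfe

end IsApproxRootSystem

end RootData

/-! ### Expressions are binomials with coprime terms. -/

namespace RootData

section Complexity

variable {A Λ : Type*} {n : ℕ} {D : RootData A n Λ}

theorem HasComplexity.isNew {i : Λ} {c : ℕ} (h : D.HasComplexity (c + 1) i) : D.IsNew i := by
  rw [HasComplexity] at h
  exact h.1

theorem HasComplexity.mem_range_of_mem_vars {i j : Λ} (h : D.HasComplexity 1 i)
    (hj : j ∈ (D.expr i).vars) : j ∈ Set.range D.param := by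
  rw [HasComplexity] at h
  obtain ⟨k, hk⟩ := h.2.1 j hj
  rw [Fin.fin_one_eq_zero k] at hk
  rwa [Fin.val_zero, HasComplexity] at hk

end Complexity

section Expression

variable {A Γ₀ Λ : Type*} [CommRing A] [Algebra ℝ A] [LinearOrderedCommGroupWithZero Γ₀]
  [LinearOrder Λ] {n : ℕ} {D : RootData A n Λ} {ν : Valuation A Γ₀} {u : Fin n → A}

namespace IsApproxRootSystem

theorem eq_of_initial_eq (hD : D.IsApproxRootSystem ν u) {i j : Λ} (hi : D.IsNew i)
    (hj : D.IsNew j) (hij : D.initial i = D.initial j) : i = j := by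
  have h := hD.initial_spec i hi
  exact (hD.existsUnique_initial _ h.1 h.2).unique ⟨hi, rfl⟩ ⟨hj, hij.symm⟩

/-- The expression of a new approximate root is a binomial. -/
theorem exists_expr_eq (hD : D.IsApproxRootSystem ν u)
    (hprop : ∀ {a b : A}, ν a ≤ ν b → ν b ≠ 0 → ∃ t : ℝ, ν (a - algebraMap ℝ A t * b) < ν b)
    {i : Λ} (hi : D.IsNew i) : ∃ (f : Λ →₀ ℕ) (l : ℝ), l ≠ 0 ∧ D.Follows ν (D.initial i) f ∧
      D.expr i = MvPolynomial.monomial (D.initial i) 1 - MvPolynomial.monomial f l := by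
  obtain ⟨q, hq⟩ : ∃ q, q = MvPolynomial.monomial (D.initial i) (1 : ℝ) - D.expr i := ⟨_, rfl⟩
  have hspec := hD.expr_spec i hi
  rw [← hq] at hspec
  have hexpr : D.expr i = MvPolynomial.monomial (D.initial i) 1 - q := by rw [hq]; ring
  have hq0 : q ≠ 0 := by
    rintro rfl
    have h := hD.val_root_lt i hi
    rw [hD.root_eq i hi, hexpr, sub_zero, aeval_monomial_root, map_one, one_mul] at h
    exact lt_irrefl _ h
  -- Of two support monomials the earlier would be dependent, so the support is a single point.
  have hcmp : ∀ f ∈ q.support, ∀ g ∈ q.support, ¬ toLex f < toLex g := by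
    intro f hf g hg hlt
    have hf' := hspec f hf
    have hg' := hspec g hg
    exact hf'.2 (Follows.isDependent hprop ⟨hg'.1.1, hg'.1.2.1.trans hf'.1.2.1.symm, hlt⟩)
  obtain ⟨f, hf⟩ := MvPolynomial.support_nonempty.2 hq0
  refine ⟨f, q.coeff f, MvPolynomial.mem_support_iff.1 hf, (hspec f hf).1, ?_⟩
  rw [hexpr]
  congr 1
  ext g
  rw [MvPolynomial.coeff_monomial]
  split_ifs with hfg
  · rw [hfg]
  · by_contra hg
    have hg' := MvPolynomial.mem_support_iff.2 hg
    rcases lt_trichotomy (toLex f) (toLex g) with h | h | h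
    · exact hcmp f hf g hg' h
    · exact hfg (toLex.injective h)
    · exact hcmp g hg' f hf h

/-- The two monomials of a binomial expression have no common factor. -/
theorem disjoint_of_follows [IsNoetherianRing A] (hD : D.IsApproxRootSystem ν u)
    (hle : ∀ a, ν a ≤ 1) (hu : ∀ k, ν (u k) < 1)
    (hprop : ∀ {a b : A}, ν a ≤ ν b → ν b ≠ 0 → ∃ t : ℝ, ν (a - algebraMap ℝ A t * b) < ν b)
    {e f : Λ →₀ ℕ} (he : D.IsStandard ν e) (hf : D.Follows ν e f) (j : Λ) :
    e j = 0 ∨ f j = 0 := by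
  by_contra! h
  obtain ⟨e', rfl⟩ : ∃ e', e = Finsupp.single j 1 + e' :=
    exists_add_of_le (Finsupp.single_le_iff.2 (Nat.one_le_iff_ne_zero.2 h.1))
  obtain ⟨f', rfl⟩ : ∃ f', f = Finsupp.single j 1 + f' :=
    exists_add_of_le (Finsupp.single_le_iff.2 (Nat.one_le_iff_ne_zero.2 h.2))
  obtain ⟨hs, hval, hlt⟩ := hf
  have h0 := he.1
  rw [mon_add, map_mul] at h0
  rw [mon_add, mon_add, map_mul, map_mul] at hval
  rw [toLex_add, toLex_add] at hlt
  -- After cancelling `Q j`, the proper divisor `e'` of `e` would lie before `f'`, of the same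
  -- value.
  exact hD.not_lex_lt_of_proper_divisor hle hu hprop he le_add_self (by simp)
    (mul_left_cancel₀ (left_ne_zero_of_mul h0) hval).symm (lt_of_add_lt_add_left hlt)

end IsApproxRootSystem

end Expression

/-! ### Monomials in the three parameters. -/

section ThreeParameters

variable {A Γ₀ Λ : Type*} (D : RootData A 3 Λ)

/-- The exponent vector of the monomial `u₁ ^ a u₂ ^ b u₃ ^ c` in the parameters. -/
noncomputable def paramExp (a b c : ℕ) : Λ →₀ ℕ :=
  Finsupp.single (D.param 0) a + Finsupp.single (D.param 1) b + Finsupp.single (D.param 2) c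

theorem monomial_paramExp (a b c : ℕ) (t : ℝ) : MvPolynomial.monomial (D.paramExp a b c) t =
    MvPolynomial.C t * (MvPolynomial.X (D.param 0) ^ a * MvPolynomial.X (D.param 1) ^ b *
      MvPolynomial.X (D.param 2) ^ c) := by
  simp only [paramExp, MvPolynomial.X_pow_eq_monomial, MvPolynomial.monomial_mul,
    MvPolynomial.C_mul_monomial, mul_one]

theorem map_mon_paramExp [CommRing A] [LinearOrderedCommGroupWithZero Γ₀] (ν : Valuation A Γ₀)
    (a b c : ℕ) : ν (D.mon (D.paramExp a b c)) =
      ν (D.root (D.param 0)) ^ a * ν (D.root (D.param 1)) ^ b * ν (D.root (D.param 2)) ^ c := by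
  simp only [paramExp, mon_add, mon_single, map_mul, map_pow]

theorem paramExp_mono {a b c a' b' c' : ℕ} (ha : a ≤ a') (hb : b ≤ b') (hc : c ≤ c') :
    D.paramExp a b c ≤ D.paramExp a' b' c' :=
  add_le_add (add_le_add (Finsupp.single_mono ha) (Finsupp.single_mono hb))
    (Finsupp.single_mono hc)

variable {D} [LinearOrder Λ]

theorem paramExp_apply (hD : StrictMono D.param) (a b c : ℕ) : D.paramExp a b c (D.param 0) = a ∧
    D.paramExp a b c (D.param 1) = b ∧ D.paramExp a b c (D.param 2) = c := by
  simp [paramExp, hD.injective.eq_iff]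

theorem eq_paramExp (hD : StrictMono D.param) {e : Λ →₀ ℕ} (he : ∀ j, e j ≠ 0 → j ∈ Set.range D.param) :
    e = D.paramExp (e (D.param 0)) (e (D.param 1)) (e (D.param 2)) := by
  ext j
  by_cases hj : j ∈ Set.range D.param
  · obtain ⟨k, rfl⟩ := hj
    obtain ⟨h0, h1, h2⟩ := paramExp_apply hD (e (D.param 0)) (e (D.param 1)) (e (D.param 2))
    fin_cases k
    · exact h0.symm
    · exact h1.symm
    · exact h2.symm
  · have h0 : ∀ k, D.param k ≠ j := fun k hk => hj ⟨k, hk⟩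
    rw [show e j = 0 from by_contra fun h => hj (he j h)]
    simp [paramExp, h0]

theorem toLex_paramExp_lt (hD : StrictMono D.param) {a b c x y z : ℕ} (h : a < x ∨ a = x ∧ (b < y ∨ b = y ∧ c < z)) :
    toLex (D.paramExp a b c) < toLex (D.paramExp x y z) := by
  obtain ⟨h0, h1, h2⟩ := paramExp_apply hD a b c
  obtain ⟨k0, k1, k2⟩ := paramExp_apply hD x y z
  have h01 : D.param 0 < D.param 1 := hD (by decide)
  have h12 : D.param 1 < D.param 2 := hD (by decide)
  rw [Finsupp.Lex.lt_iff]
  rcases h with h | ⟨rfl, h | ⟨rfl, h⟩⟩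
  · refine ⟨D.param 0, fun j hj => ?_, ?_⟩
    · change D.paramExp a b c j = D.paramExp x y z j
      simp [paramExp, hj.ne', (hj.trans h01).ne',
        (hj.trans (h01.trans h12)).ne']
    · change D.paramExp a b c _ < D.paramExp x y z _
      rwa [h0, k0]
  · refine ⟨D.param 1, fun j hj => ?_, ?_⟩
    · change D.paramExp a b c j = D.paramExp a y z j
      simp [paramExp, Finsupp.single_apply, hj.ne', (hj.trans h12).ne']
    · change D.paramExp a b c _ < D.paramExp a y z _
      rwa [h1, k1]
  · refine ⟨D.param 2, fun j hj => ?_, ?_⟩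
    · change D.paramExp a b c j = D.paramExp a b z j
      simp [paramExp, Finsupp.single_apply, hj.ne']
    · change D.paramExp a b c _ < D.paramExp a b z _
      rwa [h2, k2]

theorem toLex_paramExp_lt_iff (hD : StrictMono D.param) {a b c x y z : ℕ} :
    toLex (D.paramExp a b c) < toLex (D.paramExp x y z) ↔
      a < x ∨ a = x ∧ (b < y ∨ b = y ∧ c < z) := by
  refine ⟨fun h => ?_, toLex_paramExp_lt hD⟩
  by_contra hn
  rcases (by omega : (x < a ∨ x = a ∧ (y < b ∨ y = b ∧ z < c)) ∨ (a = x ∧ b = y ∧ c = z))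
    with h' | ⟨rfl, rfl, rfl⟩
  · exact lt_asymm h (toLex_paramExp_lt hD h')
  · exact lt_irrefl _ h

end ThreeParameters

end RootData

/-- For two monomials whose exponents of `y` and `z` are ordered oppositely, cancelling isolates a
pure power. -/
theorem eq_pow_mul_pow_of_mul_pow_eq {Γ₀ : Type*} [LinearOrderedCommGroupWithZero Γ₀]
    {x y z : Γ₀} (hy : y ≠ 0) (hz : z ≠ 0) {s p q b c : ℕ}
    (h : y ^ b * z ^ (c + q) = y ^ (b + p) * z ^ c * x ^ s) : z ^ q = x ^ s * y ^ p := by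
  have h0 : y ^ b * z ^ c ≠ 0 := mul_ne_zero (pow_ne_zero _ hy) (pow_ne_zero _ hz)
  apply mul_left_cancel₀ h0
  rw [pow_add, pow_add] at h
  calc y ^ b * z ^ c * z ^ q = y ^ b * (z ^ c * z ^ q) := mul_assoc _ _ _
    _ = y ^ b * y ^ p * z ^ c * x ^ s := h
    _ = y ^ b * z ^ c * (x ^ s * y ^ p) := by ac_rfl

/-! ### The three forms, their minimality and uniqueness. -/

namespace RootData.IsApproxRootSystem

variable {A Γ₀ Λ : Type*} [CommRing A] [Algebra ℝ A] [IsNoetherianRing A]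
  [LinearOrderedCommGroupWithZero Γ₀] [LinearOrder Λ] {D : RootData A 3 Λ} {ν : Valuation A Γ₀}
  {u : Fin 3 → A}

omit [IsNoetherianRing A] in
theorem map_mon_paramExp (hD : D.IsApproxRootSystem ν u) (a b c : ℕ) :
    ν (D.mon (D.paramExp a b c)) = ν (u 0) ^ a * ν (u 1) ^ b * ν (u 2) ^ c := by
  rw [RootData.map_mon_paramExp, hD.root_param, hD.root_param, hD.root_param]

theorem not_lt_of_isStandard_paramExp (hD : D.IsApproxRootSystem ν u) (hle : ∀ a, ν a ≤ 1)
    (hu : ∀ k, ν (u k) < 1)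
    (hprop : ∀ {a b : A}, ν a ≤ ν b → ν b ≠ 0 → ∃ t : ℝ, ν (a - algebraMap ℝ A t * b) < ν b)
    {a b c a' b' c' x y z : ℕ} (he : D.IsStandard ν (D.paramExp a b c))
    (ha : a' ≤ a) (hb : b' ≤ b) (hc : c' ≤ c) (hne : a' + b' + c' < a + b + c)
    (hval : ν (u 0) ^ a' * ν (u 1) ^ b' * ν (u 2) ^ c' =
      ν (u 0) ^ x * ν (u 1) ^ y * ν (u 2) ^ z)
    (hlt : a' < x ∨ a' = x ∧ (b' < y ∨ b' = y ∧ c' < z)) : False := by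
  refine hD.not_lex_lt_of_proper_divisor hle hu hprop he (D.paramExp_mono ha hb hc) ?_ ?_
    (toLex_paramExp_lt hD.param_strictMono hlt)
  · intro h
    obtain ⟨h0, h1, h2⟩ := paramExp_apply hD.param_strictMono a b c
    obtain ⟨k0, k1, k2⟩ := paramExp_apply hD.param_strictMono a' b' c'
    rw [← h] at h0 h1 h2
    omega
  · rw [hD.map_mon_paramExp, hD.map_mon_paramExp, hval]

/-- The expression of an approximate root of complexity one is a binomial in the parameters, whose
two monomials have no common factor. -/
theorem exists_expr_eq_paramExp (hD : D.IsApproxRootSystem ν u) (hle : ∀ a, ν a ≤ 1)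
    (hu : ∀ k, ν (u k) < 1)
    (hprop : ∀ {a b : A}, ν a ≤ ν b → ν b ≠ 0 → ∃ t : ℝ, ν (a - algebraMap ℝ A t * b) < ν b)
    {i : Λ} (hi : D.HasComplexity 1 i) : ∃ (a b c x y z : ℕ) (l : ℝ), l ≠ 0 ∧
      D.IsStandard ν (D.paramExp a b c) ∧ ν (D.mon (D.paramExp x y z)) ≠ 0 ∧
      ν (u 0) ^ a * ν (u 1) ^ b * ν (u 2) ^ c = ν (u 0) ^ x * ν (u 1) ^ y * ν (u 2) ^ z ∧
      (a = 0 ∨ x = 0) ∧ (b = 0 ∨ y = 0) ∧ (c = 0 ∨ z = 0) ∧ (a ≠ 0 ∨ b ≠ 0 ∨ c ≠ 0) ∧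
      (a < x ∨ a = x ∧ (b < y ∨ b = y ∧ c < z)) ∧ D.initial i = D.paramExp a b c ∧
      D.expr i = MvPolynomial.monomial (D.paramExp a b c) 1 -
        MvPolynomial.monomial (D.paramExp x y z) l := by
  obtain ⟨f, l, hl, hf, hexpr⟩ := hD.exists_expr_eq hprop hi.isNew
  obtain ⟨e, hinit⟩ : ∃ e, e = D.initial i := ⟨_, rfl⟩
  have hst := (hD.initial_spec i hi.isNew).1
  rw [← hinit] at hexpr hf hst
  -- Distinctness keeps the two coefficients from cancelling, so both monomials really occur and
  -- involve only parameters.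
  have hef : e ≠ f := fun h => (hf.2.2).ne (congrArg toLex h)
  have hrange : ∀ g, (D.expr i).coeff g ≠ 0 → ∀ j, g j ≠ 0 → j ∈ Set.range D.param :=
    fun g hg j hj => hi.mem_range_of_mem_vars ((MvPolynomial.mem_vars_iff_mem_support j).2
      ⟨g, MvPolynomial.mem_support_iff.2 hg, Finsupp.mem_support_iff.2 hj⟩)
  have he' := eq_paramExp hD.param_strictMono (hrange e (by
    rw [hexpr]; simp [MvPolynomial.coeff_monomial, hef.symm]))
  have hf' := eq_paramExp hD.param_strictMono (hrange f (by
    rw [hexpr]; simp [MvPolynomial.coeff_monomial, hef, hl]))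
  have hdis := hD.disjoint_of_follows hle hu hprop hst hf
  refine ⟨_, _, _, _, _, _, l, hl, he' ▸ hst, hf' ▸ hf.1.1, ?_, hdis (D.param 0),
    hdis (D.param 1), hdis (D.param 2), ?_, ?_, hinit.symm.trans he', ?_⟩
  · rw [← hD.map_mon_paramExp, ← hD.map_mon_paramExp, ← he', ← hf', hf.2.1]
  · by_contra! h
    obtain ⟨h0, h1, h2⟩ := h
    rw [h0, h1, h2] at he'
    have he0 : e = 0 := by rw [he']; simp [paramExp]
    have hlt := map_mon_lt_one hle (hD.map_root_lt_one hle hu) (he0 ▸ hef).symm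
    rw [hf.2.1, he0, mon_zero, map_one] at hlt
    exact lt_irrefl _ hlt
  · rw [← toLex_paramExp_lt_iff hD.param_strictMono, ← he', ← hf']
    exact hf.2.2
  · rw [← he', ← hf', hexpr]

/-- For minimality, compare `(β', γ')` of a smaller `α'` with `(β, γ)`. If both are at most, this is
a proper divisor lying before `u₁ ^ α'`. If they cross, cancellation equates a pure power dividing
the initial monomial with a multiple of `u₁ ^ (s + 1)`. If both are at least, the values are in the
wrong order. -/
theorem isMixedForm_of_expr_eq (hD : D.IsApproxRootSystem ν u) (hle : ∀ a, ν a ≤ 1)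
    (hu : ∀ k, ν (u k) < 1)
    (hprop : ∀ {a b : A}, ν a ≤ ν b → ν b ≠ 0 → ∃ t : ℝ, ν (a - algebraMap ℝ A t * b) < ν b)
    {i : Λ} {α β γ : ℕ} {l : ℝ} (hα : 0 < α) (hβ : 0 < β) (hγ : 0 < γ) (hl : l ≠ 0)
    (hst : D.IsStandard ν (D.paramExp 0 β γ))
    (hval : ν (u 1) ^ β * ν (u 2) ^ γ = ν (u 0) ^ α)
    (hinit : D.initial i = D.paramExp 0 β γ)
    (hexpr : D.expr i = MvPolynomial.monomial (D.paramExp 0 β γ) 1 -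
      MvPolynomial.monomial (D.paramExp α 0 0) l) : D.IsMixedForm ν u i := by
  have h0 := hst.1
  rw [hD.map_mon_paramExp, pow_zero, one_mul] at h0
  have hy : ν (u 1) ≠ 0 := ne_zero_pow hβ.ne' (left_ne_zero_of_mul h0)
  have hz : ν (u 2) ≠ 0 := ne_zero_pow hγ.ne' (right_ne_zero_of_mul h0)
  have hx : ν (u 0) ≠ 0 := ne_zero_pow hα.ne' (hval ▸ h0)
  refine ⟨α, β, γ, l, hα, hβ, hγ, hl, ?_, ?_, ⟨β, γ, hβ, hγ, ?_, ?_⟩, ?_⟩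
  · rw [hexpr, monomial_paramExp, monomial_paramExp]
    simp
  · rw [hinit]
    simp [paramExp]
  · rw [map_mul, map_pow, map_pow, map_pow, hval]
  · rw [map_pow]
    exact pow_ne_zero _ hx
  · rintro α' ⟨β', γ', hβ', hγ', hval', -⟩
    rw [map_mul, map_pow, map_pow, map_pow] at hval'
    by_contra! hlt
    have hpow : ν (u 0) ^ α < ν (u 0) ^ α' :=
      pow_lt_pow_right_of_lt_one₀ (zero_lt_iff.2 hx) (hu 0) hlt
    have hα' : 0 < α' := by
      by_contra! h
      obtain rfl : α' = 0 := by omega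
      rw [pow_zero] at hval'
      exact (mul_lt_one_of_lt_of_le (pow_lt_one₀ zero_le (hu 1) hβ'.ne')
        (pow_le_one₀ zero_le (hu 2).le)).ne hval'
    obtain ⟨s, hs⟩ := Nat.exists_eq_add_of_lt hlt
    have hrel : ν (u 1) ^ β * ν (u 2) ^ γ = ν (u 1) ^ β' * ν (u 2) ^ γ' * ν (u 0) ^ (s + 1) := by
      rw [hval, hval', ← pow_add, hs, add_assoc]
    rcases le_total β' β with hb | hb <;> rcases le_total γ' γ with hc | hc
    · refine hD.not_lt_of_isStandard_paramExp hle hu hprop hst (a' := 0) (b' := β') (c' := γ')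
        (x := α') (y := 0) (z := 0) le_rfl hb hc ?_ (by simpa using hval') (Or.inl hα')
      by_contra! h
      obtain ⟨rfl, rfl⟩ : β' = β ∧ γ' = γ := by omega
      exact hpow.ne (hval.symm.trans hval')
    · obtain ⟨p, rfl⟩ := Nat.exists_eq_add_of_le hb
      obtain ⟨q, rfl⟩ := Nat.exists_eq_add_of_le hc
      have h := eq_pow_mul_pow_of_mul_pow_eq (x := ν (u 0)) (y := ν (u 2)) (z := ν (u 1))
        (s := s + 1) (p := q) (q := p) (b := γ) (c := β') hz hy
        (by rw [mul_comm, hrel]; ac_rfl)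
      exact hD.not_lt_of_isStandard_paramExp hle hu hprop hst (a' := 0) (b' := p) (c' := 0)
        (x := s + 1) (y := 0) (z := q) (by omega) (by omega) (by omega) (by omega)
        (by simpa using h) (by omega)
    · obtain ⟨p, rfl⟩ := Nat.exists_eq_add_of_le hb
      obtain ⟨q, rfl⟩ := Nat.exists_eq_add_of_le hc
      have h := eq_pow_mul_pow_of_mul_pow_eq (x := ν (u 0)) (y := ν (u 1)) (z := ν (u 2))
        (s := s + 1) (p := p) (q := q) (b := β) (c := γ') hy hz hrel
      exact hD.not_lt_of_isStandard_paramExp hle hu hprop hst (a' := 0) (b' := 0) (c' := q)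
        (x := s + 1) (y := p) (z := 0) (by omega) (by omega) (by omega) (by omega)
        (by simpa using h) (by omega)
    · refine hpow.not_ge ?_
      rw [← hval, ← hval']
      exact mul_le_mul' (pow_le_pow_right_of_le_one' (hu 1).le hb)
        (pow_le_pow_right_of_le_one' (hu 2).le hc)

theorem isSecondPowerForm_of_expr_eq (hD : D.IsApproxRootSystem ν u) (hle : ∀ a, ν a ≤ 1)
    (hu : ∀ k, ν (u k) < 1)
    (hprop : ∀ {a b : A}, ν a ≤ ν b → ν b ≠ 0 → ∃ t : ℝ, ν (a - algebraMap ℝ A t * b) < ν b)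
    {i : Λ} {α β γ : ℕ} {l : ℝ} (hα : 0 < α) (hβ : 0 < β) (hl : l ≠ 0)
    (hst : D.IsStandard ν (D.paramExp 0 β 0))
    (hval : ν (u 1) ^ β = ν (u 0) ^ α * ν (u 2) ^ γ)
    (hinit : D.initial i = D.paramExp 0 β 0)
    (hexpr : D.expr i = MvPolynomial.monomial (D.paramExp 0 β 0) 1 -
      MvPolynomial.monomial (D.paramExp α 0 γ) l) : D.IsSecondPowerForm ν u i := by
  have h0 := hst.1
  rw [hD.map_mon_paramExp, pow_zero, one_mul, pow_zero, mul_one] at h0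
  refine ⟨α, β, γ, l, hα, hβ, hl, ?_, ?_, ⟨hβ, α, γ, hα, ?_, ?_⟩, ?_⟩
  · rw [hexpr, monomial_paramExp, monomial_paramExp]
    simp
  · rw [hinit]
    simp [paramExp]
  · rw [map_mul, map_pow, map_pow, map_pow, hval]
  · rwa [map_pow]
  · rintro β' ⟨hβ', α', γ', hα', hval', -⟩
    rw [map_mul, map_pow, map_pow, map_pow] at hval'
    by_contra! hlt
    exact hD.not_lt_of_isStandard_paramExp hle hu hprop hst (a' := 0) (b' := β') (c' := 0)
      (x := α') (y := 0) (z := γ') (by omega) (by omega) (by omega) (by omega)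
      (by simpa using hval') (by omega)

theorem isThirdPowerForm_of_expr_eq (hD : D.IsApproxRootSystem ν u) (hle : ∀ a, ν a ≤ 1)
    (hu : ∀ k, ν (u k) < 1)
    (hprop : ∀ {a b : A}, ν a ≤ ν b → ν b ≠ 0 → ∃ t : ℝ, ν (a - algebraMap ℝ A t * b) < ν b)
    {i : Λ} {α β γ : ℕ} {l : ℝ} (hγ : 0 < γ) (hl : l ≠ 0)
    (hst : D.IsStandard ν (D.paramExp 0 0 γ))
    (hval : ν (u 2) ^ γ = ν (u 0) ^ α * ν (u 1) ^ β)
    (hinit : D.initial i = D.paramExp 0 0 γ)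
    (hexpr : D.expr i = MvPolynomial.monomial (D.paramExp 0 0 γ) 1 -
      MvPolynomial.monomial (D.paramExp α β 0) l) : D.IsThirdPowerForm ν u i := by
  have h0 := hst.1
  rw [hD.map_mon_paramExp, pow_zero, one_mul, pow_zero, one_mul] at h0
  refine ⟨α, β, γ, l, hγ, hl, ?_, ?_, ⟨hγ, α, β, ?_, ?_⟩, ?_⟩
  · rw [hexpr, monomial_paramExp, monomial_paramExp]
    simp
  · rw [hinit]
    simp [paramExp]
  · rw [map_mul, map_pow, map_pow, map_pow, hval]
  · rwa [map_pow]
  · rintro γ' ⟨hγ', α', β', hval', -⟩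
    rw [map_mul, map_pow, map_pow, map_pow] at hval'
    by_contra! hlt
    refine hD.not_lt_of_isStandard_paramExp hle hu hprop hst (a' := 0) (b' := 0) (c' := γ')
      (x := α') (y := β') (z := 0) (by omega) (by omega) (by omega) (by omega)
      (by simpa using hval') ?_
    -- The competing monomial could fail to come later only if it were `1`, but `u₃ ^ γ'` has `ν`
    -- less than `1`.
    by_contra! h
    obtain ⟨rfl, rfl⟩ : α' = 0 ∧ β' = 0 := by omega
    rw [pow_zero, pow_zero, mul_one] at hval'
    exact (pow_lt_one₀ zero_le (hu 2) hγ'.ne').ne hval'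

theorem form_of_hasComplexity_one (hD : D.IsApproxRootSystem ν u) (hle : ∀ a, ν a ≤ 1)
    (hu : ∀ k, ν (u k) < 1)
    (hprop : ∀ {a b : A}, ν a ≤ ν b → ν b ≠ 0 → ∃ t : ℝ, ν (a - algebraMap ℝ A t * b) < ν b)
    {i : Λ} (hi : D.HasComplexity 1 i) :
    D.IsMixedForm ν u i ∨ D.IsSecondPowerForm ν u i ∨ D.IsThirdPowerForm ν u i := by
  obtain ⟨a, b, c, x, y, z, l, hl, hst, -, hval, hax, hby, hcz, hne, hlt, hinit, hexpr⟩ :=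
    hD.exists_expr_eq_paramExp hle hu hprop hi
  -- If `u₁` divided the initial monomial, coprimality would remove it from the other one, which
  -- would then come earlier.
  obtain rfl : a = 0 := by omega
  rcases Nat.eq_zero_or_pos b with rfl | hb
  · obtain rfl : z = 0 := by omega
    exact Or.inr (Or.inr (hD.isThirdPowerForm_of_expr_eq hle hu hprop (by omega) hl hst
      (by simpa using hval) hinit hexpr))
  · obtain rfl : y = 0 := by omega
    rcases Nat.eq_zero_or_pos c with rfl | hc
    · exact Or.inr (Or.inl (hD.isSecondPowerForm_of_expr_eq hle hu hprop (by omega) hb hl hst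
        (by simpa using hval) hinit hexpr))
    · obtain rfl : z = 0 := by omega
      exact Or.inl (hD.isMixedForm_of_expr_eq hle hu hprop (by omega) hb hc hl hst
        (by simpa using hval) hinit hexpr)

/-- Among the monomials in the last two parameters of a given value, a standard one that involves
both has the greatest exponent at `u₂`. -/
theorem le_of_isStandard_paramExp (hD : D.IsApproxRootSystem ν u) (hle : ∀ a, ν a ≤ 1)
    (hu : ∀ k, ν (u k) < 1)
    (hprop : ∀ {a b : A}, ν a ≤ ν b → ν b ≠ 0 → ∃ t : ℝ, ν (a - algebraMap ℝ A t * b) < ν b)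
    {b c b' c' : ℕ} (hst : D.IsStandard ν (D.paramExp 0 b c)) (hb : 0 < b) (hc : 0 < c)
    (hval : ν (u 1) ^ b * ν (u 2) ^ c = ν (u 1) ^ b' * ν (u 2) ^ c') : b' ≤ b := by
  by_contra! hlt
  have h0 := hst.1
  rw [hD.map_mon_paramExp, pow_zero, one_mul] at h0
  have hy : ν (u 1) ≠ 0 := ne_zero_pow hb.ne' (left_ne_zero_of_mul h0)
  have hz : ν (u 2) ≠ 0 := ne_zero_pow hc.ne' (right_ne_zero_of_mul h0)
  have hpow : ν (u 1) ^ b' < ν (u 1) ^ b :=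
    pow_lt_pow_right_of_lt_one₀ (zero_lt_iff.2 hy) (hu 1) hlt
  rcases le_total c c' with hcc | hcc
  · refine ((mul_le_mul_right (pow_le_pow_right_of_le_one' (hu 2).le hcc) _).trans_lt
      (mul_lt_mul_of_pos_right hpow (zero_lt_iff.2 (pow_ne_zero c hz)))).ne hval.symm
  -- Cancelling gives `u₃ ^ q` the value of the later `u₂ ^ p`; it is a proper divisor because `0 <
  -- b`.
  · obtain ⟨p, rfl⟩ := Nat.exists_eq_add_of_le hlt.le
    obtain ⟨q, rfl⟩ := Nat.exists_eq_add_of_le hcc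
    have h := eq_pow_mul_pow_of_mul_pow_eq (x := ν (u 0)) (s := 0) hy hz
      (by rw [hval, pow_zero, mul_one])
    exact hD.not_lt_of_isStandard_paramExp hle hu hprop hst (a' := 0) (b' := 0) (c' := q)
      (x := 0) (y := p) (z := 0) (by omega) (by omega) (by omega) (by omega)
      (by simpa using h) (by omega)

/-- Both initial monomials have the value of `u₁ ^ α` for the common least `α`. Being standard, they
bound each other's exponent of `u₂`; the exponents of `u₃` then agree by strict monotonicity of
powers. -/
theorem eq_of_isMixedForm (hD : D.IsApproxRootSystem ν u) (hle : ∀ a, ν a ≤ 1)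
    (hu : ∀ k, ν (u k) < 1)
    (hprop : ∀ {a b : A}, ν a ≤ ν b → ν b ≠ 0 → ∃ t : ℝ, ν (a - algebraMap ℝ A t * b) < ν b)
    {i j : Λ} (hi : D.IsNew i) (hj : D.IsNew j) (hi' : D.IsMixedForm ν u i)
    (hj' : D.IsMixedForm ν u j) : i = j := by
  have key : ∀ {k α β γ} {l : ℝ}, D.IsNew k → l ≠ 0 →
      D.expr k = MvPolynomial.X (D.param 1) ^ β * MvPolynomial.X (D.param 2) ^ γ
        - MvPolynomial.C l * MvPolynomial.X (D.param 0) ^ α →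
      D.initial k = Finsupp.single (D.param 1) β + Finsupp.single (D.param 2) γ →
      D.initial k = D.paramExp 0 β γ ∧ D.IsStandard ν (D.paramExp 0 β γ) ∧
        ν (u 1) ^ β * ν (u 2) ^ γ = ν (u 0) ^ α := by
    intro k α β γ l hk hl hexpr hinit
    have hinit' : D.initial k = D.paramExp 0 β γ := by rw [hinit]; simp [paramExp]
    refine ⟨hinit', hinit' ▸ (hD.initial_spec k hk).1, ?_⟩
    have h := (hD.expr_spec k hk (D.paramExp α 0 0) ?_).1.2.1
    · rw [hinit', hD.map_mon_paramExp, hD.map_mon_paramExp] at h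
      simpa using h.symm
    · have : MvPolynomial.monomial (D.initial k) 1 - D.expr k =
          MvPolynomial.monomial (D.paramExp α 0 0) l := by
        rw [hinit', hexpr, monomial_paramExp, monomial_paramExp]
        simp
      rw [this, MvPolynomial.mem_support_iff, MvPolynomial.coeff_monomial, if_pos rfl]
      exact hl
  obtain ⟨α, β, γ, l, hα, hβ, hγ, hl, hexpr, hinit, hmin⟩ := hi'
  obtain ⟨α', β', γ', l', hα', hβ', hγ', hl', hexpr', hinit', hmin'⟩ := hj'
  obtain rfl := hmin.unique hmin'
  obtain ⟨hin, hst, hval⟩ := key hi hl hexpr hinit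
  obtain ⟨hin', hst', hval'⟩ := key hj hl' hexpr' hinit'
  have hvv := hval.trans hval'.symm
  obtain rfl : β = β' :=
    le_antisymm (hD.le_of_isStandard_paramExp hle hu hprop hst' hβ' hγ' hvv.symm)
      (hD.le_of_isStandard_paramExp hle hu hprop hst hβ hγ hvv)
  have h0 := hst.1
  rw [hD.map_mon_paramExp, pow_zero, one_mul] at h0
  obtain rfl : γ = γ' := (pow_right_strictAnti₀ (zero_lt_iff.2
    (ne_zero_pow hγ.ne' (right_ne_zero_of_mul h0))) (hu 2)).injective
      (mul_left_cancel₀ (left_ne_zero_of_mul h0) hvv)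
  exact hD.eq_of_initial_eq hi hj (hin.trans hin'.symm)

-- The least exponent alone determines the initial monomial, hence the root.
omit [IsNoetherianRing A] in
theorem eq_of_isSecondPowerForm (hD : D.IsApproxRootSystem ν u) {i j : Λ} (hi : D.IsNew i)
    (hj : D.IsNew j) (hi' : D.IsSecondPowerForm ν u i) (hj' : D.IsSecondPowerForm ν u j) :
    i = j := by
  obtain ⟨α, β, γ, l, -, -, -, -, hinit, hmin⟩ := hi'
  obtain ⟨α', β', γ', l', -, -, -, -, hinit', hmin'⟩ := hj'
  obtain rfl := hmin.unique hmin'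
  exact hD.eq_of_initial_eq hi hj (hinit.trans hinit'.symm)

omit [IsNoetherianRing A] in
theorem eq_of_isThirdPowerForm (hD : D.IsApproxRootSystem ν u) {i j : Λ} (hi : D.IsNew i)
    (hj : D.IsNew j) (hi' : D.IsThirdPowerForm ν u i) (hj' : D.IsThirdPowerForm ν u j) :
    i = j := by
  obtain ⟨α, β, γ, l, -, -, -, hinit, hmin⟩ := hi'
  obtain ⟨α', β', γ', l', -, -, -, hinit', hmin'⟩ := hj'
  obtain rfl := hmin.unique hmin'
  exact hD.eq_of_initial_eq hi hj (hinit.trans hinit'.symm)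

end RootData.IsApproxRootSystem

theorem lemma6p1 {A Γ₀ Λ : Type*} [CommRing A] [Algebra ℝ A] [IsRegularLocalRing A]
    [LinearOrderedCommGroupWithZero Γ₀] [LinearOrder Λ]
    (hdim : ringKrullDim A = 3)
    (hres : Function.Bijective (algebraMap ℝ (IsLocalRing.ResidueField A)))
    (u : Fin 3 → A) (hu : Ideal.span (Set.range u) = IsLocalRing.maximalIdeal A)
    (α : RingPreordering A) [α.IsOrdering]
    (ν : Valuation A Γ₀) (hν : IsValuationOfPoint α ν)
    (hcent : ∀ a ∈ IsLocalRing.maximalIdeal A, ν a < 1)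
    (D : RootData A 3 Λ) (hD : D.IsApproxRootSystem ν u) :
    {i : Λ | D.HasComplexity 1 i}.encard ≤ 3 ∧
    (∀ i, D.HasComplexity 1 i →
      D.IsMixedForm ν u i ∨ D.IsSecondPowerForm ν u i ∨ D.IsThirdPowerForm ν u i) ∧
    {i : Λ | D.HasComplexity 1 i ∧ D.IsMixedForm ν u i}.Subsingleton ∧
    {i : Λ | D.HasComplexity 1 i ∧ D.IsSecondPowerForm ν u i}.Subsingleton ∧
    {i : Λ | D.HasComplexity 1 i ∧ D.IsThirdPowerForm ν u i}.Subsingleton := by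
  have hle := hν.map_le_one
  have hu1 : ∀ k, ν (u k) < 1 := fun k =>
    hcent _ (hu ▸ Ideal.subset_span (Set.mem_range_self k))
  have hprop : ∀ {a b : A}, ν a ≤ ν b → ν b ≠ 0 →
      ∃ t : ℝ, ν (a - algebraMap ℝ A t * b) < ν b :=
    fun hab hb => hν.exists_map_sub_lt hres.surjective hcent hab hb
  have hform : ∀ i, D.HasComplexity 1 i →
      D.IsMixedForm ν u i ∨ D.IsSecondPowerForm ν u i ∨ D.IsThirdPowerForm ν u i :=
    fun i hi => hD.form_of_hasComplexity_one hle hu1 hprop hi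
  have h1 : {i : Λ | D.HasComplexity 1 i ∧ D.IsMixedForm ν u i}.Subsingleton :=
    fun i hi j hj => hD.eq_of_isMixedForm hle hu1 hprop hi.1.isNew hj.1.isNew hi.2 hj.2
  have h2 : {i : Λ | D.HasComplexity 1 i ∧ D.IsSecondPowerForm ν u i}.Subsingleton :=
    fun i hi j hj => hD.eq_of_isSecondPowerForm hi.1.isNew hj.1.isNew hi.2 hj.2
  have h3 : {i : Λ | D.HasComplexity 1 i ∧ D.IsThirdPowerForm ν u i}.Subsingleton :=
    fun i hi j hj => hD.eq_of_isThirdPowerForm hi.1.isNew hj.1.isNew hi.2 hj.2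
  refine ⟨?_, hform, h1, h2, h3⟩
  have hsub : {i : Λ | D.HasComplexity 1 i} ⊆
      {i : Λ | D.HasComplexity 1 i ∧ D.IsMixedForm ν u i} ∪
        ({i : Λ | D.HasComplexity 1 i ∧ D.IsSecondPowerForm ν u i} ∪
          {i : Λ | D.HasComplexity 1 i ∧ D.IsThirdPowerForm ν u i}) := by
    intro i hi
    rcases hform i hi with h | h | h
    · exact Or.inl ⟨hi, h⟩
    · exact Or.inr (Or.inl ⟨hi, h⟩)
    · exact Or.inr (Or.inr ⟨hi, h⟩)
  refine (Set.encard_le_encard hsub).trans ((Set.encard_union_le _ _).trans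
    ((add_le_add (Set.encard_le_one_iff_subsingleton.2 h1) ((Set.encard_union_le _ _).trans
      (add_le_add (Set.encard_le_one_iff_subsingleton.2 h2)
        (Set.encard_le_one_iff_subsingleton.2 h3)))).trans ?_))
  norm_num
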